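/- Let $H$ be a complex Hilbert space and let $L\subseteq\mathcal B(H)$ be a norm closed $*$-subalgebra of the algebra of bounded operators on $H$ containing the identity operator $I$ (that is, a unital $C^*$-algebra represented on $H$). Let $L^{-1}$, $L_{\mathrm s}$ and $L_{\mathrm f}$ be the sets of invertible operators in $L$, of self-adjoint operators in $L$, and of operators in $L$ with finite spectrum, respectively, and let $\overline M$ denote the norm closure of $M\subseteq L$. For a normal operator $A$ and a Borel set $\Omega\subseteq\mathbb C$ let $\Pi_\Omega$ denote the spectral projection of $A$ corresponding to $\Omega$. Then the following statements are equivalent. 1. $L$ has real rank zero, that is, $\overline{L^{-1}\cap L_{\mathrm s}}=L_{\mathrm s}$. 2. For every $A\in L_{\mathrm s}$ and every finite family $\{\Omega_j\}_{j=1}^m$ of open subsets of $\mathbb C$ with $\sigma(A)\subseteq\bigcup_j\Omega_j$ there exist mutually orthogonal projections $P_1,\dots,P_m\in L$ such that $\sum_{j=1}^mP_j=I$ and $P_jH\subseteq\Pi_{\Omega_j}H$ for all $j=1,\dots,m$, where $\Pi_{\Omega_j}$ are the spectral projections of $A$ corresponding to the sets $\Omega_j$. 3. $L_{\mathrm s}=\overline{L_{\mathrm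 f}\cap L_{\mathrm s}}$. -/

import Mathlib

open scoped InnerProductSpace CompactlySupported

namespace SpectralTheory

variable {H : Type*} [NormedAddCommGroup H] [InnerProductSpace ℂ H] [CompleteSpace H]

/-- `f(A)` for a real-valued compactly supported continuous `f`, by the continuous functional
calculus of the normal operator `A` (junk value `0` if `A` is not normal). -/
noncomputable def realCfc (A : H →L[ℂ] H) (f : C_c(ℂ, ℝ)) : H →L[ℂ] H :=
  cfc (fun z : ℂ => ((f z : ℝ) : ℂ)) A

theorem realCfc_add (A : H →L[ℂ] H) (f g : C_c(ℂ, ℝ)) :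
    realCfc A (f + g) = realCfc A f + realCfc A g := by
  unfold realCfc
  rw [← cfc_add ..]
  simp

theorem realCfc_smul (A : H →L[ℂ] H) (c : ℝ) (f : C_c(ℂ, ℝ)) :
    realCfc A (c • f) = (c : ℂ) • realCfc A f := by
  unfold realCfc
  rw [← cfc_smul ..]
  simp

theorem realCfc_isSelfAdjoint (A : H →L[ℂ] H) (f : C_c(ℂ, ℝ)) :
    IsSelfAdjoint (realCfc A f) := by
  unfold realCfc
  rw [isSelfAdjoint_iff, ← cfc_star]
  simp

theorem realCfc_inner_nonneg (A : H →L[ℂ] H) (f : C_c(ℂ, ℝ)) (hf : ∀ z, 0 ≤ f z) (x : H) :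
    0 ≤ (⟪x, realCfc A f x⟫_ℂ).re := by
  have hc : ContinuousOn (fun z : ℂ => ((Real.sqrt (f z) : ℝ) : ℂ)) (spectrum ℂ A) :=
    (Complex.continuous_ofReal.comp (Real.continuous_sqrt.comp f.continuous)).continuousOn
  have h : realCfc A f = star (cfc (fun z : ℂ => ((Real.sqrt (f z) : ℝ) : ℂ)) A) *
      cfc (fun z : ℂ => ((Real.sqrt (f z) : ℝ) : ℂ)) A := by
    unfold realCfc
    rw [← cfc_star, ← cfc_mul _ _ _ (by simpa using hc) hc]
    congr 1
    funext z
    simp [← Complex.ofReal_mul, Real.mul_self_sqrt (hf z)]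
  rw [h, mul_apply_eq_comp, ContinuousLinearMap.star_eq_adjoint,
    ContinuousLinearMap.adjoint_inner_right]
  exact inner_self_nonneg (𝕜 := ℂ)

theorem realCfc_inner_le (A : H →L[ℂ] H) (f : C_c(ℂ, ℝ)) (hf : ∀ z, ‖f z‖ ≤ 1) (x : H) :
    (⟪x, realCfc A f x⟫_ℂ).re ≤ ‖x‖ ^ 2 := by
  have h1 : ‖realCfc A f‖ ≤ 1 := by
    unfold realCfc
    exact norm_cfc_le zero_le_one (fun z _ => by simpa using hf z)
  calc (⟪x, realCfc A f x⟫_ℂ).re ≤ ‖⟪x, realCfc A f x⟫_ℂ‖ := Complex.re_le_norm _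
    _ ≤ ‖x‖ * ‖realCfc A f x‖ := norm_inner_le_norm _ _
    _ ≤ ‖x‖ * (1 * ‖x‖) := by
        gcongr
        exact (realCfc A f).le_of_opNorm_le h1 x
    _ = ‖x‖ ^ 2 := by ring

theorem realCfc_inner_ofReal (A : H →L[ℂ] H) (f : C_c(ℂ, ℝ)) (x : H) :
    (((⟪x, realCfc A f x⟫_ℂ).re : ℝ) : ℂ) = ⟪x, realCfc A f x⟫_ℂ := by
  have h := (ContinuousLinearMap.isSelfAdjoint_iff_isSymmetric.mp (realCfc_isSelfAdjoint A f))
  rw [← Complex.conj_eq_iff_re, inner_conj_symm]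
  exact h x x

/-- The positive linear functional `f ↦ ⟪x, f(A) x⟫` on `C_c(ℂ, ℝ)`. -/
noncomputable def scalarFunctional (A : H →L[ℂ] H) (x : H) : C_c(ℂ, ℝ) →ₚ[ℝ] ℝ :=
  PositiveLinearMap.mk₀
    { toFun := fun f => (⟪x, realCfc A f x⟫_ℂ).re
      map_add' := fun f g => by simp [realCfc_add]
      map_smul' := fun c f => by simp [realCfc_smul] }
    (fun f hf => realCfc_inner_nonneg A f hf x)

theorem scalarFunctional_apply (A : H →L[ℂ] H) (x : H) (f : C_c(ℂ, ℝ)) :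
    scalarFunctional A x f = (⟪x, realCfc A f x⟫_ℂ).re := rfl

/-- The scalar spectral measure `μ_x` of the normal operator `A` at the vector `x`: the (unique)
regular Borel measure on `ℂ` with `∫ f dμ_x = ⟪x, f(A) x⟫` for all `f ∈ C_c(ℂ, ℝ)`, as given by the
Riesz-Markov-Kakutani theorem. -/
noncomputable def scalarSpectralMeasure (A : H →L[ℂ] H) (x : H) : MeasureTheory.Measure ℂ :=
  RealRMK.rieszMeasure (scalarFunctional A x)

instance (A : H →L[ℂ] H) (x : H) : (scalarSpectralMeasure A x).Regular := by
  unfold scalarSpectralMeasure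
  infer_instance

theorem integral_scalarSpectralMeasure (A : H →L[ℂ] H) (x : H) (f : C_c(ℂ, ℝ)) :
    ∫ z, f z ∂(scalarSpectralMeasure A x) = (⟪x, realCfc A f x⟫_ℂ).re :=
  RealRMK.integral_rieszMeasure _ f

theorem scalarSpectralMeasure_le (A : H →L[ℂ] H) (x : H) (S : Set ℂ) :
    scalarSpectralMeasure A x S ≤ ENNReal.ofReal (‖x‖ ^ 2) := by
  refine (MeasureTheory.measure_mono (Set.subset_univ S)).trans ?_
  rw [isOpen_univ.measure_eq_iSup_isCompact]
  refine iSup₂_le fun K _ => iSup_le fun hK => ?_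
  obtain ⟨g, hg1, -, hgc, hg01⟩ :=
    exists_continuous_one_zero_of_isCompact hK isClosed_empty (Set.disjoint_empty K)
  let f : C_c(ℂ, ℝ) := ⟨g, hgc⟩
  have h0 : ∀ z, 0 ≤ f z := fun z => (hg01 z).1
  refine (RealRMK.rieszMeasure_le_of_eq_one (scalarFunctional A x) (f := f) h0 hK
    (fun z hz => hg1 hz)).trans ?_
  refine ENNReal.ofReal_le_ofReal (realCfc_inner_le A f (fun z => ?_) x)
  rw [Real.norm_eq_abs, abs_of_nonneg (h0 z)]
  exact (hg01 z).2

instance (A : H →L[ℂ] H) (x : H) :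
    MeasureTheory.IsFiniteMeasure (scalarSpectralMeasure A x) :=
  ⟨(scalarSpectralMeasure_le A x _).trans_lt ENNReal.ofReal_lt_top⟩

theorem real_scalarSpectralMeasure_le (A : H →L[ℂ] H) (x : H) (S : Set ℂ) :
    (scalarSpectralMeasure A x).real S ≤ ‖x‖ ^ 2 :=
  ENNReal.toReal_le_of_le_ofReal (by positivity) (scalarSpectralMeasure_le A x S)

/-- A real linear relation between the quadratic forms `T ↦ ⟪x i, T x i⟫` passes to the scalar
spectral measures. -/
theorem sum_real_scalarSpectralMeasure_eq_zero (A : H →L[ℂ] H) {ι : Type*} [Fintype ι]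
    (a : ι → ℝ) (x : ι → H)
    (h : ∀ f : C_c(ℂ, ℝ), ∑ i, a i * (⟪x i, realCfc A f (x i)⟫_ℂ).re = 0) (S : Set ℂ) :
    ∑ i, a i * (scalarSpectralMeasure A (x i)).real S = 0 := by
  let m (b : ι → ℝ) : MeasureTheory.Measure ℂ :=
    ∑ i, (b i).toNNReal • scalarSpectralMeasure A (x i)
  have hint (b : ι → ℝ) (f : C_c(ℂ, ℝ)) :
      ∫ z, f z ∂(m b) = ∑ i, ((b i).toNNReal : ℝ) * (⟪x i, realCfc A f (x i)⟫_ℂ).re := by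
    rw [MeasureTheory.integral_finsetSum_measure]
    · refine Finset.sum_congr rfl fun i _ => ?_
      rw [MeasureTheory.integral_smul_nnreal_measure, integral_scalarSpectralMeasure]
      rfl
    · intro i _
      exact f.continuous.integrable_of_hasCompactSupport f.hasCompactSupport
  have hreal (b : ι → ℝ) :
      (m b).real S = ∑ i, ((b i).toNNReal : ℝ) * (scalarSpectralMeasure A (x i)).real S := by
    simp only [m, MeasureTheory.Measure.real, MeasureTheory.Measure.finsetSum_apply]
    rw [ENNReal.toReal_sum]
    · refine Finset.sum_congr rfl fun i _ => ?_
      rw [MeasureTheory.Measure.coe_nnreal_smul_apply, ENNReal.toReal_mul, ENNReal.coe_toReal]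
    · intro i _
      exact MeasureTheory.measure_ne_top _ _
  have hsub (i : ι) (t : ℝ) :
      a i * t = ((a i).toNNReal : ℝ) * t - ((-a i).toNNReal : ℝ) * t := by
    rw [← sub_mul, Real.coe_toNNReal', Real.coe_toNNReal', max_zero_sub_eq_self]
  have heq : m a = m (fun i => -a i) := by
    apply MeasureTheory.Measure.ext_of_integral_eq_on_compactlySupported
    intro f
    rw [hint, hint, ← sub_eq_zero, ← Finset.sum_sub_distrib, ← h f]
    exact Finset.sum_congr rfl fun i _ => (hsub i _).symm
  rw [Finset.sum_congr rfl fun i _ => hsub i _, Finset.sum_sub_distrib, ← hreal, ← hreal, heq,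
    sub_self]

theorem sum_ofReal_scalarSpectralMeasure_eq_zero (A : H →L[ℂ] H) {ι : Type*} [Fintype ι]
    (a : ι → ℂ) (x : ι → H) (h : ∀ T : H →L[ℂ] H, ∑ i, a i * ⟪x i, T (x i)⟫_ℂ = 0) (S : Set ℂ) :
    ∑ i, a i * (((scalarSpectralMeasure A (x i)).real S : ℝ) : ℂ) = 0 := by
  have h' (f : C_c(ℂ, ℝ)) :
      ∑ i, a i * (((⟪x i, realCfc A f (x i)⟫_ℂ).re : ℝ) : ℂ) = 0 := by
    simpa only [realCfc_inner_ofReal] using h (realCfc A f)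
  apply Complex.ext
  · have := sum_real_scalarSpectralMeasure_eq_zero A (fun i => (a i).re) x
      (fun f => by simpa only [Complex.re_sum, Complex.re_mul_ofReal, Complex.zero_re]
        using congrArg Complex.re (h' f)) S
    simpa only [Complex.re_sum, Complex.re_mul_ofReal, Complex.zero_re] using this
  · have := sum_real_scalarSpectralMeasure_eq_zero A (fun i => (a i).im) x
      (fun f => by simpa only [Complex.im_sum, Complex.im_mul_ofReal, Complex.zero_im]
        using congrArg Complex.im (h' f)) S
    simpa only [Complex.im_sum, Complex.im_mul_ofReal, Complex.zero_im] using this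

/-- The sesquilinear form obtained by polarization from `x ↦ μ_x(S)`. -/
noncomputable def spectralForm (A : H →L[ℂ] H) (S : Set ℂ) (x y : H) : ℂ :=
  ∑ k : Fin 4, (4⁻¹ * (-Complex.I) ^ (k : ℕ)) *
    (((scalarSpectralMeasure A (x + Complex.I ^ (k : ℕ) • y)).real S : ℝ) : ℂ)

theorem inner_polarization {H : Type*} [NormedAddCommGroup H] [InnerProductSpace ℂ H]
    (T : H →L[ℂ] H) (x y : H) :
    ∑ k : Fin 4, (4⁻¹ * (-Complex.I) ^ (k : ℕ)) *
      ⟪x + Complex.I ^ (k : ℕ) • y, T (x + Complex.I ^ (k : ℕ) • y)⟫_ℂ = ⟪x, T y⟫_ℂ := by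
  have h2 : Complex.I ^ 2 = -1 := Complex.I_sq
  have h3 : Complex.I ^ 3 = -Complex.I := by rw [pow_succ, h2]; ring
  have h3' : (-Complex.I) ^ 3 = Complex.I := by rw [Odd.neg_pow (by decide), h3, neg_neg]
  have h2' : (-Complex.I) ^ 2 = -1 := by rw [neg_sq, h2]
  simp only [Fin.sum_univ_four, Fin.val_zero, Fin.val_one, Fin.val_two,
    show ((3 : Fin 4) : ℕ) = 3 from rfl, pow_zero, pow_one, h2, h3, h2', h3', map_add, map_smul,
    inner_add_left, inner_add_right, inner_smul_left, inner_smul_right, map_neg, map_one,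
    Complex.conj_I]
  ring_nf
  simp only [h2]
  ring

theorem sum_spectralForm_eq_zero (A : H →L[ℂ] H) (S : Set ℂ) {κ : Type*} [Fintype κ]
    (b : κ → ℂ) (u v : κ → H) (h : ∀ T : H →L[ℂ] H, ∑ j, b j * ⟪u j, T (v j)⟫_ℂ = 0) :
    ∑ j, b j * spectralForm A S (u j) (v j) = 0 := by
  have := sum_ofReal_scalarSpectralMeasure_eq_zero A
    (fun p : κ × Fin 4 => b p.1 * (4⁻¹ * (-Complex.I) ^ (p.2 : ℕ)))
    (fun p => u p.1 + Complex.I ^ (p.2 : ℕ) • v p.1)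
    (fun T => by
      rw [Fintype.sum_prod_type, ← h T]
      refine Finset.sum_congr rfl fun j _ => ?_
      simp only [mul_assoc (b j)]
      rw [← Finset.mul_sum, inner_polarization]) S
  rw [Fintype.sum_prod_type] at this
  rw [← this]
  refine Finset.sum_congr rfl fun j _ => ?_
  simp only [mul_assoc (b j)]
  rw [← Finset.mul_sum, spectralForm]

theorem spectralForm_self (A : H →L[ℂ] H) (S : Set ℂ) (x : H) :
    spectralForm A S x x = (((scalarSpectralMeasure A x).real S : ℝ) : ℂ) := by
  have := sum_ofReal_scalarSpectralMeasure_eq_zero A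
    (fun p : Option (Fin 4) => p.elim (-1) fun k => 4⁻¹ * (-Complex.I) ^ (k : ℕ))
    (fun p => p.elim x fun k => x + Complex.I ^ (k : ℕ) • x)
    (fun T => by
      simp only [Fintype.sum_option, Option.elim]
      rw [inner_polarization]
      ring) S
  simp only [Fintype.sum_option, Option.elim] at this
  rw [spectralForm]
  linear_combination this

theorem norm_spectralForm_le_add (A : H →L[ℂ] H) (S : Set ℂ) (x y : H) :
    ‖spectralForm A S x y‖ ≤ (‖x‖ + ‖y‖) ^ 2 := by
  refine (norm_sum_le _ _).trans ?_
  have h (k : Fin 4) : ‖(4⁻¹ * (-Complex.I) ^ (k : ℕ)) *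
      (((scalarSpectralMeasure A (x + Complex.I ^ (k : ℕ) • y)).real S : ℝ) : ℂ)‖ ≤
      4⁻¹ * (‖x‖ + ‖y‖) ^ 2 := by
    have h1 : ‖x + Complex.I ^ (k : ℕ) • y‖ ≤ ‖x‖ + ‖y‖ := by
      simpa [norm_smul] using norm_add_le x (Complex.I ^ (k : ℕ) • y)
    have h2 := (real_scalarSpectralMeasure_le A (x + Complex.I ^ (k : ℕ) • y) S).trans
      (pow_le_pow_left₀ (norm_nonneg _) h1 2)
    simpa [abs_of_nonneg] using h2
  refine (Finset.sum_le_sum fun k _ => h k).trans (le_of_eq ?_)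
  simp

/-- The form `spectralForm A S` as a linear object. -/
noncomputable def spectralSesq (A : H →L[ℂ] H) (S : Set ℂ) : H →ₗ⋆[ℂ] H →ₗ[ℂ] ℂ :=
  LinearMap.mk₂'ₛₗ (starRingEnd ℂ) (RingHom.id ℂ) (spectralForm A S)
    (fun x x' y => by
      have := sum_spectralForm_eq_zero A S ![1, -1, -1] ![x + x', x, x'] ![y, y, y]
        (fun T => by simp [Fin.sum_univ_three])
      simp only [Fin.sum_univ_three, Matrix.cons_val] at this
      linear_combination this)
    (fun c x y => by
      have := sum_spectralForm_eq_zero A S ![1, -(starRingEnd ℂ) c] ![c • x, x] ![y, y]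
        (fun T => by simp [Fin.sum_univ_two, mul_comm])
      simp only [Fin.sum_univ_two, Matrix.cons_val] at this
      rw [smul_eq_mul]
      linear_combination this)
    (fun x y y' => by
      have := sum_spectralForm_eq_zero A S ![1, -1, -1] ![x, x, x] ![y + y', y, y']
        (fun T => by simp [Fin.sum_univ_three])
      simp only [Fin.sum_univ_three, Matrix.cons_val] at this
      linear_combination this)
    (fun c x y => by
      have := sum_spectralForm_eq_zero A S ![1, -c] ![x, x] ![c • y, y]
        (fun T => by simp [Fin.sum_univ_two])
      simp only [Fin.sum_univ_two, Matrix.cons_val] at this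
      rw [smul_eq_mul, RingHom.id_apply]
      linear_combination this)

theorem spectralSesq_apply (A : H →L[ℂ] H) (S : Set ℂ) (x y : H) :
    spectralSesq A S x y = spectralForm A S x y := rfl

theorem norm_spectralSesq_le (A : H →L[ℂ] H) (S : Set ℂ) (x y : H) :
    ‖spectralSesq A S x y‖ ≤ 4 * ‖x‖ * ‖y‖ := by
  rcases eq_or_ne x 0 with rfl | hx
  · simp
  rcases eq_or_ne y 0 with rfl | hy
  · simp
  have hx' : (0 : ℝ) < ‖x‖ := norm_pos_iff.mpr hx
  have hy' : (0 : ℝ) < ‖y‖ := norm_pos_iff.mpr hy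
  have h := norm_spectralForm_le_add A S (((‖x‖⁻¹ : ℝ) : ℂ) • x) (((‖y‖⁻¹ : ℝ) : ℂ) • y)
  rw [← spectralSesq_apply, map_smul, LinearMap.map_smulₛₗ, LinearMap.smul_apply] at h
  simp only [norm_smul, smul_eq_mul, norm_mul, RCLike.norm_conj, Complex.norm_real, norm_inv,
    norm_norm, inv_mul_cancel₀ hx'.ne', inv_mul_cancel₀ hy'.ne'] at h
  have h4 : ‖spectralSesq A S x y‖ =
      ‖x‖ * ‖y‖ * (‖y‖⁻¹ * (‖x‖⁻¹ * ‖spectralSesq A S x y‖)) := by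
    field_simp
  rw [h4]
  calc _ ≤ ‖x‖ * ‖y‖ * (1 + 1) ^ 2 := by gcongr
    _ = 4 * ‖x‖ * ‖y‖ := by ring

/-- The spectral projection `Π_S` of the normal operator `A` corresponding to a Borel set `S ⊆ ℂ`:
the bounded operator with `⟪x, Π_S x⟫ = μ_x(S)` for all `x`, where `μ_x` is the scalar spectral
measure of `A` at `x` (over `ℂ` an operator is determined by its quadratic form). -/
noncomputable def spectralProjection (A : H →L[ℂ] H) (S : Set ℂ) : H →L[ℂ] H :=
  InnerProductSpace.continuousLinearMapOfBilin
    ((spectralSesq A S).mkContinuous₂ 4 (norm_spectralSesq_le A S))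

theorem inner_spectralProjection (A : H →L[ℂ] H) (S : Set ℂ) (x : H) :
    ⟪x, spectralProjection A S x⟫_ℂ = (((scalarSpectralMeasure A x).real S : ℝ) : ℂ) := by
  rw [← inner_conj_symm, spectralProjection,
    InnerProductSpace.continuousLinearMapOfBilin_apply, LinearMap.mkContinuous₂_apply,
    spectralSesq_apply, spectralForm_self, Complex.conj_ofReal]

/-- The set `L⁻¹` of invertible operators in `L`. (By inverse closedness of C*-subalgebras the
inverse is automatically in `L` when `L` is norm closed.) -/
def invertibles (L : StarSubalgebra ℂ (H →L[ℂ] H)) : Set (H →L[ℂ] H) :=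
  {A | A ∈ L ∧ IsUnit A}

/-- The set `L_s` of self-adjoint operators in `L`. -/
def selfAdjoints (L : StarSubalgebra ℂ (H →L[ℂ] H)) : Set (H →L[ℂ] H) :=
  {A | A ∈ L ∧ IsSelfAdjoint A}

/-- The set `L_f` of operators in `L` with finite spectrum. -/
def finiteSpectrum (L : StarSubalgebra ℂ (H →L[ℂ] H)) : Set (H →L[ℂ] H) :=
  {A | A ∈ L ∧ (spectrum ℂ A).Finite}

/-- `L` has real rank zero: the invertible self-adjoint operators in `L` are norm dense in the
self-adjoint operators in `L`. -/
def HasRealRankZero (L : StarSubalgebra ℂ (H →L[ℂ] H)) : Prop :=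
  closure (invertibles L ∩ selfAdjoints L) = selfAdjoints L

/-- `A` has approximate spectral projections in `L` associated with the family `Ω`: mutually
orthogonal projections `P j ∈ L` which sum up to the identity, such that the range of `P j` is
contained in the range of the spectral projection of `A` corresponding to `Ω j`. -/
def HasApproxSpectralProjections (L : StarSubalgebra ℂ (H →L[ℂ] H)) (A : H →L[ℂ] H) {m : ℕ}
    (Ω : Fin m → Set ℂ) : Prop :=
  ∃ P : Fin m → (H →L[ℂ] H),
    (∀ j, P j ∈ L) ∧ (∀ j, IsStarProjection (P j)) ∧ (∀ i j, i ≠ j → P i * P j = 0) ∧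
    ∑ j, P j = 1 ∧
    ∀ j, Set.range (P j) ⊆ Set.range (spectralProjection A (Ω j))

end SpectralTheory

/-! 1 → 2. Write `A` for a self-adjoint element of `L`. The spectral projections of `A` need not lie
in `L`, but real rank zero supplies substitutes: for `a < b` there is a cut, a projection `E ∈ L`
that dominates the spectral subspace of `A` for `(-∞, a]` and is orthogonal to the one for `[b, ∞)`
(`exists_cut`). After a shift, approximate `A` by an invertible self-adjoint `C ∈ L`. The spectral
projections of `C` for the two half-lines lie in `L`, because `0` is a gap in the spectrum, but they
cut `A` only approximately. Compressing by functions of `A` makes the behaviour on the two spectral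
subspaces exact while moving the operator so little that the gap survives, and the positive
projection of the corrected operator is a cut. Cuts along a fine grid form an increasing chain from
`0` to `1`. Each successive difference lives over a short interval, which the Lebesgue number lemma
places inside a single `Ω j`; grouping the differences by `j` gives the `P j`.

2 → 3. Cover the spectrum by intervals of half-width `ε` around grid points `λ j`. The `P j` need
not commute with `A`, yet `‖A - ∑ λ j P j‖ ≤ 3 ε` (`norm_sub_sum_smul_le`), and `∑ λ j P j` has
finite spectrum.

3 → 1. A self-adjoint element with finite spectrum becomes invertible after an arbitrarily small
real shift. -/

theorem StarSubalgebra.cfc_real_mem {B : Type*} [CStarAlgebra B] {L : StarSubalgebra ℂ B}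
    (hL : IsClosed (L : Set B)) (f : ℝ → ℝ) {a : B} (ha : a ∈ L) : cfc f a ∈ L := by
  have : IsClosed (L : Set B) := hL
  exact cfc_mem f ha

theorem exists_continuous_ramp {c d : ℝ} (h : c < d) :
    ∃ φ : ℝ → ℝ, Continuous φ ∧ (∀ x ≤ c, φ x = 0) ∧ (∀ x, d ≤ x → φ x = 1) ∧
      ∀ x, 0 ≤ φ x ∧ φ x ≤ 1 := by
  have hd : 0 < d - c := sub_pos.mpr h
  refine ⟨fun x => max 0 (min 1 ((x - c) / (d - c))), by fun_prop, fun x hx => ?_, fun x hx => ?_,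
    fun x => ⟨le_max_left _ _, max_le zero_le_one (min_le_left _ _)⟩⟩
  · exact max_eq_left ((min_le_right _ _).trans (div_nonpos_of_nonpos_of_nonneg (by linarith) hd.le))
  · have : 1 ≤ (x - c) / (d - c) := by rw [le_div_iff₀ hd]; linarith
    simp [min_eq_left this]

/-! ### Exact spectral cuts in a closed star subalgebra of real rank zero. -/

section Cut

variable {B : Type*} [CStarAlgebra B]

/-- An invertible self-adjoint element has a positive spectral projection in every closed star
subalgebra that contains it. -/
theorem exists_positive_projection {L : StarSubalgebra ℂ B} (hL : IsClosed (L : Set B)) {S : B}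
    (hSL : S ∈ L) (hS : IsSelfAdjoint S) (hu : IsUnit S) :
    ∃ E ∈ L, IsStarProjection E ∧
      (∀ h : ℝ → ℝ, Continuous h → (∀ x, 0 < x → h x = 0) → E * cfc h S = 0) ∧
      ∀ h : ℝ → ℝ, Continuous h → (∀ x, x < 0 → h x = 0) → (1 - E) * cfc h S = 0 := by
  have h0 : ∀ x ∈ spectrum ℝ S, x ≠ 0 := fun x hx hx0 => by
    subst hx0
    exact spectrum.zero_notMem ℝ hu hx
  set χ : ℝ → ℝ := fun x => if 0 < x then 1 else 0 with hχ
  -- The only jump of `χ` is at `0`, which is outside the spectrum.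
  have hc : ContinuousOn χ (spectrum ℝ S) := by
    intro x hx
    refine ContinuousAt.continuousWithinAt ?_
    rcases (h0 x hx).lt_or_gt with h | h
    · refine (continuousAt_const (y := (0 : ℝ))).congr ?_
      filter_upwards [Iio_mem_nhds h] with y hy
      exact (if_neg (not_lt.mpr (le_of_lt hy))).symm
    · refine (continuousAt_const (y := (1 : ℝ))).congr ?_
      filter_upwards [Ioi_mem_nhds h] with y hy
      exact (if_pos hy).symm
  have hzero (k : ℝ → ℝ) (hk : ∀ x ∈ spectrum ℝ S, k x = 0) : cfc k S = 0 := by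
    rw [cfc_congr (g := fun _ => (0 : ℝ)) hk, cfc_const_zero]
  refine ⟨cfc χ S, StarSubalgebra.cfc_real_mem hL χ hSL, ⟨?_, cfc_predicate χ S⟩, fun h hh hz => ?_,
    fun h hh hz => ?_⟩
  · rw [IsIdempotentElem, ← cfc_mul χ χ S]
    refine cfc_congr fun x _ => ?_
    by_cases hx : 0 < x <;> simp [hχ, hx]
  · rw [← cfc_mul χ h S hc hh.continuousOn]
    refine hzero _ fun x _ => ?_
    by_cases hx : 0 < x <;> simp [hχ, hx, hz]
  · rw [sub_mul, one_mul, ← cfc_mul χ h S hc hh.continuousOn,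
      ← cfc_sub h (fun x => χ x * h x) S hh.continuousOn (hc.mul hh.continuousOn)]
    refine hzero _ fun x hx => ?_
    rcases (h0 x hx).lt_or_gt with h | h
    · simp [hχ, h.not_gt, hz x h]
    · simp [hχ, h]

/-- With `r x = (max 0 x + t)⁻¹`, the function `r x * (x + t) - 1` vanishes for `x > 0`. Hence `E =
E * r(S) * (S + t)`, and `S + t` annihilates `F`. -/
theorem mul_eq_zero_of_eigen {S E F : B} (hS : IsSelfAdjoint S) {t : ℝ} (ht : 0 < t)
    (hE : ∀ h : ℝ → ℝ, Continuous h → (∀ x, 0 < x → h x = 0) → E * cfc h S = 0)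
    (hF : S * F = (-t) • F) : E * F = 0 := by
  have hpos (x : ℝ) : max 0 x + t ≠ 0 := by positivity
  have hr : Continuous fun x : ℝ => (max 0 x + t)⁻¹ := by
    exact Continuous.inv₀ (by fun_prop) hpos
  have h1 := hE (fun x => (max 0 x + t)⁻¹ * (x + t) - 1)
    ((hr.mul (by fun_prop)).sub continuous_const) fun x hx => by
    rw [max_eq_right hx.le, inv_mul_cancel₀ (by positivity), sub_self]
  rw [cfc_sub (fun x => (max 0 x + t)⁻¹ * (x + t)) (fun _ => 1) S
      (hr.mul (by fun_prop)).continuousOn continuousOn_const,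
    cfc_mul _ (fun x => x + t) S hr.continuousOn (by fun_prop),
    cfc_add_const t (fun x => x) S (by fun_prop), cfc_id' ℝ S, cfc_const_one ℝ S] at h1
  have h2 : (S + algebraMap ℝ B t) * F = 0 := by
    rw [add_mul, hF, ← Algebra.smul_def, neg_smul, neg_add_cancel]
  calc E * F = -(E * (cfc (fun x : ℝ => (max 0 x + t)⁻¹) S * (S + algebraMap ℝ B t) - 1)) * F
        + E * cfc (fun x : ℝ => (max 0 x + t)⁻¹) S * ((S + algebraMap ℝ B t) * F) := by noncomm_ring
    _ = 0 := by rw [h1, h2]; simp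

theorem one_sub_mul_eq_zero_of_eigen {S E F : B} (hS : IsSelfAdjoint S) {t : ℝ} (ht : 0 < t)
    (hE : ∀ h : ℝ → ℝ, Continuous h → (∀ x, x < 0 → h x = 0) → (1 - E) * cfc h S = 0)
    (hF : S * F = t • F) : (1 - E) * F = 0 := by
  refine mul_eq_zero_of_eigen (S := -S) hS.neg ht (fun h hh hz => ?_)
    (by rw [neg_mul, hF, neg_smul])
  rw [← cfc_comp_neg h S]
  exact hE _ (by fun_prop) fun x hx => hz _ (by linarith)

/-- A symmetry `S` is its own inverse and a contraction, so the Neumann series inverts `S * T`. -/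
theorem isUnit_of_norm_sub_lt {S T : B} (hS : S * S = 1) (hn : ‖S‖ ≤ 1) (h : ‖T - S‖ < 1) :
    IsUnit T := by
  have h1 : ‖1 - S * T‖ < 1 := by
    calc ‖1 - S * T‖ = ‖S * (S - T)‖ := by rw [mul_sub, hS]
      _ ≤ ‖S‖ * ‖S - T‖ := norm_mul_le _ _
      _ ≤ 1 * ‖S - T‖ := by gcongr
      _ < 1 := by rwa [one_mul, norm_sub_rev]
  have h2 : IsUnit (S * T) := by
    simpa using (Units.oneSub (1 - S * T) h1).isUnit
  have h1' : IsUnit S := ⟨⟨S, S, hS, hS⟩, rfl⟩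
  have h3 : IsUnit (S * (S * T)) := h1'.mul h2
  rwa [← mul_assoc, hS, one_mul] at h3

/-- If `Q` almost dominates `F` and is almost orthogonal to `G`, compressing `Q` by `1 - G` and then
its complement by `1 - F` changes little. The difference from `1 - Q` expands into six terms, each
of norm at most `η` once the contractions are dropped. -/
theorem norm_conj_compression_sub_le {F G Q : B} {η : ℝ} (hF : ‖F‖ ≤ 1) (hF' : ‖1 - F‖ ≤ 1)
    (hG : ‖G‖ ≤ 1) (h1 : ‖F * (1 - Q)‖ ≤ η) (h2 : ‖(1 - Q) * F‖ ≤ η) (h3 : ‖G * Q‖ ≤ η)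
    (h4 : ‖Q * G‖ ≤ η) :
    ‖(1 - F) * (1 - (1 - G) * Q * (1 - G)) * (1 - F) - (1 - Q)‖ ≤ 6 * η := by
  have hη : 0 ≤ η := (norm_nonneg _).trans h1
  have key : (1 - F) * (1 - (1 - G) * Q * (1 - G)) * (1 - F) - (1 - Q) =
      (1 - F) * (G * Q + Q * G - G * Q * G) * (1 - F) - F * (1 - Q) - (1 - Q) * F
        + F * (1 - Q) * F := by
    noncomm_ring
  have h5 : ‖G * Q * G‖ ≤ η := by
    calc ‖G * Q * G‖ ≤ ‖G * Q‖ * ‖G‖ := norm_mul_le _ _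
      _ ≤ η * 1 := by gcongr
      _ = η := mul_one η
  have h6 : ‖F * (1 - Q) * F‖ ≤ η := by
    calc ‖F * (1 - Q) * F‖ ≤ ‖F * (1 - Q)‖ * ‖F‖ := norm_mul_le _ _
      _ ≤ η * 1 := by gcongr
      _ = η := mul_one η
  have h7 : ‖G * Q + Q * G - G * Q * G‖ ≤ 3 * η := by
    calc _ ≤ ‖G * Q‖ + ‖Q * G‖ + ‖G * Q * G‖ :=
          (norm_sub_le _ _).trans (by gcongr; exact norm_add_le _ _)
      _ ≤ 3 * η := by linarith
  have h8 : ‖(1 - F) * (G * Q + Q * G - G * Q * G) * (1 - F)‖ ≤ 3 * η := by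
    calc _ ≤ ‖1 - F‖ * ‖G * Q + Q * G - G * Q * G‖ * ‖1 - F‖ :=
          (norm_mul_le _ _).trans (by gcongr; exact norm_mul_le _ _)
      _ ≤ 1 * (3 * η) * 1 := by gcongr
      _ = 3 * η := by ring
  rw [key]
  calc _ ≤ ‖(1 - F) * (G * Q + Q * G - G * Q * G) * (1 - F)‖ + ‖F * (1 - Q)‖ + ‖(1 - Q) * F‖
        + ‖F * (1 - Q) * F‖ := by
        refine (norm_add_le _ _).trans ?_
        gcongr
        refine (norm_sub_le _ _).trans ?_
        gcongr
        exact norm_sub_le _ _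
    _ ≤ 6 * η := by linarith

/-- A projection `E` in `L` that contains the spectral subspace of `A` for `(-∞, a]` and is
orthogonal to the one for `[b, ∞)`. -/
structure IsCut (L : StarSubalgebra ℂ B) (A : B) (a b : ℝ) (E : B) : Prop where
  mem : E ∈ L
  proj : IsStarProjection E
  one_sub_mul_cfc : ∀ h : ℝ → ℝ, Continuous h → (∀ x ∈ spectrum ℝ A, a < x → h x = 0) →
    (1 - E) * cfc h A = 0
  mul_cfc : ∀ h : ℝ → ℝ, Continuous h → (∀ x ∈ spectrum ℝ A, x < b → h x = 0) →
    E * cfc h A = 0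

/-- `Q` is the negative spectral projection of an invertible `C` near `A`. It cuts `C` exactly, and
`cfc f`, `cfc g` are continuous at `A` along self-adjoint elements, so it cuts `A` up to `η`. -/
theorem exists_approx_cut {L : StarSubalgebra ℂ B} (hL : IsClosed (L : Set B))
    (hr : ∀ S ∈ L, IsSelfAdjoint S → S ∈ closure {T : B | T ∈ L ∧ IsSelfAdjoint T ∧ IsUnit T})
    {A : B} (hAL : A ∈ L) (hA : IsSelfAdjoint A) {f g : ℝ → ℝ} (hf : Continuous f)
    (hg : Continuous g) (hf0 : ∀ x, 0 ≤ x → f x = 0) (hg0 : ∀ x ≤ 0, g x = 0) {η : ℝ}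
    (hη : 0 < η) :
    ∃ Q ∈ L, IsStarProjection Q ∧ ‖cfc f A * (1 - Q)‖ ≤ η ∧ ‖(1 - Q) * cfc f A‖ ≤ η ∧
      ‖cfc g A * Q‖ ≤ η ∧ ‖Q * cfc g A‖ ≤ η := by
  have hcont (k : ℝ → ℝ) (hk : Continuous k) :
      Filter.Tendsto (cfc k) (nhdsWithin A {a : B | IsSelfAdjoint a}) (nhds (cfc k A)) :=
    ContinuousOn.cfc_of_mem_nhdsSet (s := Set.univ) k Filter.univ_mem continuousOn_id
      (fun _ hx => hx) hk.continuousOn A hA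
  have hev : ∀ᶠ C in nhdsWithin A {a : B | IsSelfAdjoint a},
      ‖cfc f C - cfc f A‖ < η ∧ ‖cfc g C - cfc g A‖ < η := by
    have h1 := (hcont f hf).eventually (Metric.ball_mem_nhds _ hη)
    have h2 := (hcont g hg).eventually (Metric.ball_mem_nhds _ hη)
    filter_upwards [h1, h2] with C h1 h2
    exact ⟨by simpa [dist_eq_norm] using h1, by simpa [dist_eq_norm] using h2⟩
  obtain ⟨U, hU, hUs⟩ := mem_nhdsWithin_iff_exists_mem_nhds_inter.mp hev
  obtain ⟨C, hCU, hCL, hC, hCu⟩ := mem_closure_iff_nhds.mp (hr A hAL hA) U hU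
  obtain ⟨h1, h2⟩ := hUs ⟨hCU, hC⟩
  obtain ⟨E, hEL, hE, hE1, hE2⟩ := exists_positive_projection hL hCL hC hCu
  have hfE : E * cfc f C = 0 := hE1 f hf fun x hx => hf0 x hx.le
  have hgE : (1 - E) * cfc g C = 0 := hE2 g hg fun x hx => hg0 x hx.le
  have hbound {P X Y : B} (hP : IsStarProjection P) (hX : IsSelfAdjoint X) (hY : IsSelfAdjoint Y)
      (h : P * Y = 0) (hXY : ‖Y - X‖ < η) : ‖X * P‖ ≤ η ∧ ‖P * X‖ ≤ η := by
    have h3 : ‖P * X‖ ≤ η := by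
      calc ‖P * X‖ = ‖P * (Y - X)‖ := by rw [mul_sub, h, zero_sub, norm_neg]
        _ ≤ ‖P‖ * ‖Y - X‖ := norm_mul_le _ _
        _ ≤ 1 * η := by gcongr; exact hP.norm_le
        _ = η := one_mul η
    refine ⟨?_, h3⟩
    rwa [← norm_star, star_mul, hP.isSelfAdjoint.star_eq, hX.star_eq]
  have hf' := hbound hE (cfc_predicate f A) (cfc_predicate f C) hfE h1
  have hg' := hbound hE.one_sub (cfc_predicate g A) (cfc_predicate g C) hgE h2
  exact ⟨1 - E, sub_mem (one_mem L) hEL, hE.one_sub, by simpa using hf'.1, by simpa using hf'.2,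
    hg'.1, hg'.2⟩

/-- The operator `T` below is close to `1 - Q`, equals `0` exactly on the spectral subspace of `A`
for `(-∞, -δ]`, where `F = 1`, and equals `1` exactly on the one for `[δ, ∞)`, where `F = 0` and `G
= 1`. So `S = 1 - 2T` is invertible, with value `1` on the former and `-1` on the latter. -/
theorem exists_cut_zero {L : StarSubalgebra ℂ B} (hL : IsClosed (L : Set B))
    (hr : ∀ S ∈ L, IsSelfAdjoint S → S ∈ closure {T : B | T ∈ L ∧ IsSelfAdjoint T ∧ IsUnit T})
    {A : B} (hAL : A ∈ L) (hA : IsSelfAdjoint A) {δ : ℝ} (hδ : 0 < δ) :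
    ∃ E, IsCut L A (-δ) δ E := by
  obtain ⟨φ, hφ, hφ0, hφ1, hφb⟩ := exists_continuous_ramp (neg_lt_zero.mpr hδ)
  obtain ⟨g, hg, hg0, hg1, hgb⟩ := exists_continuous_ramp hδ
  obtain ⟨f, hf, hf0, hf1, hfb⟩ : ∃ f : ℝ → ℝ, Continuous f ∧ (∀ x, 0 ≤ x → f x = 0) ∧
      (∀ x ≤ -δ, f x = 1) ∧ ∀ x, 0 ≤ f x ∧ f x ≤ 1 :=
    ⟨fun x => 1 - φ x, by fun_prop, fun x hx => by simp [hφ1 x hx],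
      fun x hx => by simp [hφ0 x hx], fun x => ⟨by linarith [hφb x], by linarith [hφb x]⟩⟩
  -- The bound `6 * η` is doubled in passing from `T` to `S`, and `12 / 16 < 1`.
  obtain ⟨Q, hQL, hQ, h1, h2, h3, h4⟩ :=
    exists_approx_cut hL hr hAL hA hf hg hf0 hg0 (η := 1 / 16) (by norm_num)
  have hnorm (k : ℝ → ℝ) (hk : ∀ x, 0 ≤ k x ∧ k x ≤ 1) : ‖cfc k A‖ ≤ 1 :=
    norm_cfc_le zero_le_one fun x _ => by
      rw [Real.norm_eq_abs, abs_of_nonneg (hk x).1]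
      exact (hk x).2
  have hFn := hnorm f hfb
  have hGn := hnorm g hgb
  have hFn' : ‖1 - cfc f A‖ ≤ 1 := by
    rw [← cfc_const_one ℝ A, ← cfc_sub _ _ A]
    exact hnorm _ fun x => ⟨by linarith [hfb x], by linarith [hfb x]⟩
  have hFs : IsSelfAdjoint (cfc f A) := cfc_predicate f A
  have hGs : IsSelfAdjoint (cfc g A) := cfc_predicate g A
  have hFL : cfc f A ∈ L := StarSubalgebra.cfc_real_mem hL f hAL
  have hGL : cfc g A ∈ L := StarSubalgebra.cfc_real_mem hL g hAL
  have hcut (h : ℝ → ℝ) (hh : Continuous h) (hz : ∀ x ∈ spectrum ℝ A, -δ < x → h x = 0) :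
      cfc f A * cfc h A = cfc h A := by
    rw [← cfc_mul f h A]
    refine cfc_congr fun x hx => ?_
    rcases le_or_gt x (-δ) with h' | h'
    · simp [hf1 x h']
    · simp [hz x hx h']
  have hcut' (h : ℝ → ℝ) (hh : Continuous h) (hz : ∀ x ∈ spectrum ℝ A, x < δ → h x = 0) :
      cfc f A * cfc h A = 0 ∧ cfc g A * cfc h A = cfc h A := by
    rw [← cfc_mul f h A, ← cfc_mul g h A]
    refine ⟨?_, cfc_congr fun x hx => ?_⟩
    · rw [cfc_congr (g := fun _ => (0 : ℝ)) fun x hx => ?_, cfc_const_zero]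
      rcases le_or_gt δ x with h' | h'
      · simp [hf0 x (hδ.le.trans h')]
      · simp [hz x hx h']
    · rcases le_or_gt δ x with h' | h'
      · simp [hg1 x h']
      · simp [hz x hx h']
  set F := cfc f A
  set G := cfc g A
  have hT := norm_conj_compression_sub_le hFn hFn' hGn h1 h2 h3 h4
  set T := (1 - F) * (1 - (1 - G) * Q * (1 - G)) * (1 - F) with hTdef
  have hTL : T ∈ L := by
    have h1L := one_mem L
    exact mul_mem (mul_mem (sub_mem h1L hFL) (sub_mem h1L (mul_mem (mul_mem (sub_mem h1L hGL) hQL)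
      (sub_mem h1L hGL)))) (sub_mem h1L hFL)
  have hTs : IsSelfAdjoint T := by
    rw [isSelfAdjoint_iff, hTdef]
    simp only [star_mul, star_sub, star_one, hFs.star_eq, hGs.star_eq,
      hQ.isSelfAdjoint.star_eq, mul_assoc]
  set S : B := 1 - (T + T) with hSdef
  have hSL : S ∈ L := sub_mem (one_mem L) (add_mem hTL hTL)
  have hSs : IsSelfAdjoint S := (IsSelfAdjoint.one B).sub (hTs.add hTs)
  have hQQ := hQ.isIdempotentElem.eq
  have hU2 : (Q + Q - 1) * (Q + Q - 1) = 1 := by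
    calc (Q + Q - 1) * (Q + Q - 1) = 4 * (Q * Q) - 4 * Q + 1 := by noncomm_ring
      _ = 1 := by rw [hQQ]; simp
  have hU : ‖Q + Q - 1‖ ≤ 1 := by
    have hsa : IsSelfAdjoint (Q + Q - 1) :=
      (hQ.isSelfAdjoint.add hQ.isSelfAdjoint).sub (IsSelfAdjoint.one B)
    have h5 := CStarRing.norm_star_mul_self (x := Q + Q - 1)
    rw [hsa.star_eq, hU2] at h5
    have h6 : ‖(1 : B)‖ ≤ 1 := (IsStarProjection.one B).norm_le
    nlinarith [norm_nonneg (Q + Q - 1)]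
  -- `S` is compared with the symmetry `2Q - 1`.
  have hSu : IsUnit S := by
    refine isUnit_of_norm_sub_lt hU2 hU ?_
    calc ‖S - (Q + Q - 1)‖ = ‖(T - (1 - Q)) + (T - (1 - Q))‖ := by
          rw [← norm_neg, hSdef]; congr 1; abel
      _ ≤ ‖T - (1 - Q)‖ + ‖T - (1 - Q)‖ := norm_add_le _ _
      _ < 1 := by linarith
  obtain ⟨E, hEL, hE, hE1, hE2⟩ := exists_positive_projection hL hSL hSs hSu
  refine ⟨E, hEL, hE, fun h hh hz => ?_, fun h hh hz => ?_⟩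
  · refine one_sub_mul_eq_zero_of_eigen hSs one_pos hE2 ?_
    have h5 : T * cfc h A = 0 := by
      rw [hTdef, mul_assoc, sub_mul 1 F (cfc h A), one_mul, hcut h hh hz, sub_self, mul_zero]
    rw [hSdef, sub_mul, add_mul, h5, one_mul, one_smul]
    simp
  · refine mul_eq_zero_of_eigen hSs one_pos hE1 ?_
    obtain ⟨h5, h6⟩ := hcut' h hh hz
    have h7 : (1 - F) * cfc h A = cfc h A := by rw [sub_mul, one_mul, h5, sub_zero]
    have h8 : (1 - G) * cfc h A = 0 := by rw [sub_mul, one_mul, h6, sub_self]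
    have h9 : T * cfc h A = cfc h A := by
      rw [hTdef, mul_assoc, h7, mul_assoc, sub_mul 1 _ (cfc h A), mul_assoc, h8, mul_zero, one_mul,
        sub_zero, h7]
    rw [hSdef, sub_mul, add_mul, h9, one_mul, neg_smul, one_smul]
    abel

theorem exists_cut {L : StarSubalgebra ℂ B} (hL : IsClosed (L : Set B))
    (hr : ∀ S ∈ L, IsSelfAdjoint S → S ∈ closure {T : B | T ∈ L ∧ IsSelfAdjoint T ∧ IsUnit T})
    {A : B} (hAL : A ∈ L) (hA : IsSelfAdjoint A) {a b : ℝ} (hab : a < b) :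
    ∃ E, IsCut L A a b E := by
  set c := (a + b) / 2 with hc
  have hA' : cfc (fun x : ℝ => x - c) A = A - algebraMap ℝ B c := by
    rw [cfc_sub _ _ A, cfc_id' ℝ A, cfc_const c A]
  have hAL' : A - algebraMap ℝ B c ∈ L := by
    rw [← hA']
    exact StarSubalgebra.cfc_real_mem hL _ hAL
  have hAs : IsSelfAdjoint (A - algebraMap ℝ B c) := by
    rw [← hA']
    exact cfc_predicate _ A
  have hspec : ∀ x ∈ spectrum ℝ (A - algebraMap ℝ B c), x + c ∈ spectrum ℝ A := by
    intro x hx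
    rw [← hA', cfc_map_spectrum (fun x : ℝ => x - c) A] at hx
    obtain ⟨y, hy, rfl⟩ := hx
    simpa using hy
  have htr (h : ℝ → ℝ) (hh : Continuous h) :
      cfc h A = cfc (fun x => h (x + c)) (A - algebraMap ℝ B c) := by
    rw [← hA', ← cfc_comp' (fun x => h (x + c)) (fun x : ℝ => x - c) A]
    simp
  obtain ⟨E, hE⟩ := exists_cut_zero hL hr hAL' hAs (δ := (b - a) / 2) (by linarith)
  refine ⟨E, hE.mem, hE.proj, fun h hh hz => ?_, fun h hh hz => ?_⟩
  · rw [htr h hh]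
    exact hE.one_sub_mul_cfc _ (by fun_prop) fun x hx hx' => hz _ (hspec x hx) (by rw [hc]; linarith)
  · rw [htr h hh]
    exact hE.mul_cfc _ (by fun_prop) fun x hx hx' => hz _ (hspec x hx) (by rw [hc]; linarith)

end Cut

/-! ### Spectral projections of open sets against the continuous functional calculus. -/

namespace SpectralTheory

variable {H : Type*} [NormedAddCommGroup H] [InnerProductSpace ℂ H] [CompleteSpace H]

theorem realCfc_eq_cfc {A : H →L[ℂ] H} (hA : IsSelfAdjoint A) (f : C_c(ℂ, ℝ)) :
    realCfc A f = cfc (fun x : ℝ => f (x : ℂ)) A := by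
  rw [realCfc, cfc_complex_eq_real A (by simp)]
  simp

theorem apply_eq_zero_of_inner_eq_zero {T : H →L[ℂ] H} (hT : 0 ≤ T) {x : H}
    (hx : ⟪x, T x⟫_ℂ = 0) : T x = 0 := by
  obtain ⟨S, rfl⟩ := CStarAlgebra.nonneg_iff_eq_star_mul_self.mp hT
  rw [mul_apply_eq_comp, ContinuousLinearMap.star_eq_adjoint,
    ContinuousLinearMap.adjoint_inner_right, inner_self_eq_zero] at hx
  rw [mul_apply_eq_comp, hx, map_zero]

theorem spectralProjection_nonneg (A : H →L[ℂ] H) (S : Set ℂ) : 0 ≤ spectralProjection A S := by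
  rw [ContinuousLinearMap.nonneg_iff_isPositive, ContinuousLinearMap.isPositive_iff_complex]
  intro x
  rw [← inner_conj_symm, inner_spectralProjection]
  simp

theorem spectralProjection_le_one (A : H →L[ℂ] H) (S : Set ℂ) : spectralProjection A S ≤ 1 := by
  rw [← sub_nonneg, ContinuousLinearMap.nonneg_iff_isPositive,
    ContinuousLinearMap.isPositive_iff_complex]
  intro x
  rw [← inner_conj_symm, sub_apply, inner_sub_right, inner_spectralProjection,
    one_apply_eq_self, inner_self_eq_norm_sq_to_K]
  have h := real_scalarSpectralMeasure_le A x S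
  rw [map_sub, Complex.conj_ofReal, ← RCLike.ofReal_pow, RCLike.conj_ofReal]
  simpa [← Complex.ofReal_pow, ← Complex.ofReal_sub] using h

/-- Here `‖y‖² = ∫ f dμ_y ≤ μ_y(Ω) ≤ ‖y‖²`, so the quadratic form of the positive operator `1 - Π_Ω`
vanishes at `y`. Only `0 ≤ Π_Ω ≤ 1` enters; idempotence is not needed. -/
theorem spectralProjection_apply_of_realCfc_apply {A : H →L[ℂ] H} {Ω : Set ℂ} (hΩ : IsOpen Ω)
    {f : C_c(ℂ, ℝ)} (hf1 : ∀ z, f z ≤ 1) (hf : ∀ z ∉ Ω, f z = 0) {y : H}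
    (hy : realCfc A f y = y) : spectralProjection A Ω y = y := by
  have h1 : ‖y‖ ^ 2 ≤ (scalarSpectralMeasure A y).real Ω := by
    have h2 := integral_scalarSpectralMeasure A y f
    rw [hy, inner_self_eq_norm_sq_to_K] at h2
    calc ‖y‖ ^ 2 = ∫ z, f z ∂(scalarSpectralMeasure A y) := by rw [h2]; norm_cast
      _ ≤ ∫ z, Ω.indicator 1 z ∂(scalarSpectralMeasure A y) := by
        refine MeasureTheory.integral_mono
          (f.continuous.integrable_of_hasCompactSupport f.hasCompactSupport)
          ((MeasureTheory.integrable_const (1 : ℝ)).indicator hΩ.measurableSet) fun z => ?_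
        by_cases hz : z ∈ Ω
        · simpa [hz] using hf1 z
        · simp [hz, hf z hz]
      _ = _ := MeasureTheory.integral_indicator_one hΩ.measurableSet
  have h3 : (scalarSpectralMeasure A y).real Ω = ‖y‖ ^ 2 :=
    le_antisymm (real_scalarSpectralMeasure_le A y Ω) h1
  have h4 : (1 - spectralProjection A Ω) y = 0 := by
    refine apply_eq_zero_of_inner_eq_zero (sub_nonneg.mpr (spectralProjection_le_one A Ω)) ?_
    rw [sub_apply, inner_sub_right, inner_spectralProjection, h3, one_apply_eq_self,
      inner_self_eq_norm_sq_to_K]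
    simp
  rw [sub_apply, one_apply_eq_self, sub_eq_zero] at h4
  exact h4.symm

/-- The measure of `Ω` at the vector `f(A) x` is zero: by inner regularity it suffices to treat
compact `K ⊆ Ω`, and a bump `k` that is `1` on `K` and `0` off `Ω` satisfies `k(A) f(A) = 0`. -/
theorem spectralProjection_mul_cfc_eq_zero {A : H →L[ℂ] H} (hA : IsSelfAdjoint A) {Ω : Set ℂ}
    (hΩ : IsOpen Ω) {f : ℝ → ℝ} (hf : Continuous f) (hz : ∀ x : ℝ, (x : ℂ) ∈ Ω → f x = 0) :
    spectralProjection A Ω * cfc f A = 0 := by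
  ext x
  rw [mul_apply_eq_comp, zero_apply]
  refine apply_eq_zero_of_inner_eq_zero (spectralProjection_nonneg A Ω) ?_
  have hm : scalarSpectralMeasure A (cfc f A x) Ω = 0 := by
    rw [hΩ.measure_eq_iSup_isCompact]
    simp only [ENNReal.iSup_eq_zero]
    intro K hKΩ hK
    obtain ⟨g, hg1, hg0, hgc, hg01⟩ := exists_continuous_one_zero_of_isCompact hK
      hΩ.isClosed_compl (Set.disjoint_compl_right_iff_subset.mpr hKΩ)
    let k : C_c(ℂ, ℝ) := ⟨g, hgc⟩
    have h := RealRMK.rieszMeasure_le_of_eq_one (scalarFunctional A (cfc f A x)) (f := k)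
      (fun z => (hg01 z).1) hK (fun z hz => hg1 hz)
    have h0 : realCfc A k * cfc f A = 0 := by
      rw [realCfc_eq_cfc hA, ← cfc_mul (fun x : ℝ => k (x : ℂ)) f A
        (k.continuous.comp Complex.continuous_ofReal).continuousOn hf.continuousOn,
        cfc_congr (g := fun _ => (0 : ℝ)) fun x _ => ?_, cfc_const_zero]
      by_cases hx : (x : ℂ) ∈ Ω
      · simp [hz x hx]
      · simp [show k (x : ℂ) = 0 from hg0 hx]
    rw [scalarFunctional_apply, ← mul_apply_eq_comp, h0] at h
    simpa [scalarSpectralMeasure] using h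
  rw [inner_spectralProjection, MeasureTheory.Measure.real, hm]
  simp

theorem cfc_mul_eq_zero_of_range_subset {A : H →L[ℂ] H} (hA : IsSelfAdjoint A) {Ω : Set ℂ}
    (hΩ : IsOpen Ω) {P : H →L[ℂ] H} (hP : Set.range P ⊆ Set.range (spectralProjection A Ω))
    {f : ℝ → ℝ} (hf : Continuous f) (hz : ∀ x : ℝ, (x : ℂ) ∈ Ω → f x = 0) : cfc f A * P = 0 := by
  have h1 : cfc f A * spectralProjection A Ω = 0 := by
    have h2 := congrArg star (spectralProjection_mul_cfc_eq_zero hA hΩ hf hz)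
    rwa [star_mul, star_zero, (IsSelfAdjoint.of_nonneg (spectralProjection_nonneg A Ω)).star_eq,
      (cfc_predicate f A : IsSelfAdjoint _).star_eq] at h2
  ext x
  obtain ⟨y, hy⟩ := hP ⟨x, rfl⟩
  rw [mul_apply_eq_comp, ← hy, ← mul_apply_eq_comp, h1, zero_apply, zero_apply]

/-! ### Approximation by finite spectrum, and the return to real rank zero. -/

theorem norm_sq_sum_of_pairwise_orthogonal {H : Type*} [NormedAddCommGroup H]
    [InnerProductSpace ℂ H] {ι : Type*} (s : Finset ι) (y : ι → H)
    (h : ∀ i ∈ s, ∀ j ∈ s, i ≠ j → ⟪y i, y j⟫_ℂ = 0) :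
    ‖∑ i ∈ s, y i‖ ^ 2 = ∑ i ∈ s, ‖y i‖ ^ 2 := by
  classical
  induction s using Finset.induction_on with
  | empty => simp
  | insert a s ha ih =>
    have h0 : ⟪y a, ∑ i ∈ s, y i⟫_ℂ = 0 := by
      rw [inner_sum]
      exact Finset.sum_eq_zero fun j hj => h a (Finset.mem_insert_self a s) j
        (Finset.mem_insert_of_mem hj) (ne_of_mem_of_not_mem hj ha).symm
    rw [Finset.sum_insert ha, Finset.sum_insert ha, norm_add_sq (𝕜 := ℂ), h0,
      ih fun i hi j hj => h i (Finset.mem_insert_of_mem hi) j (Finset.mem_insert_of_mem hj)]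
    simp

theorem isStarProjection_sum {B ι : Type*} [Ring B] [StarRing B] (s : Finset ι) (P : ι → B)
    (hP : ∀ i ∈ s, IsStarProjection (P i))
    (hPP : ∀ i ∈ s, ∀ j ∈ s, i ≠ j → P i * P j = 0) : IsStarProjection (∑ i ∈ s, P i) := by
  refine ⟨?_, isSelfAdjoint_sum s fun i hi => (hP i hi).isSelfAdjoint⟩
  rw [IsIdempotentElem, Finset.sum_mul_sum]
  refine Finset.sum_congr rfl fun i hi => ?_
  rw [Finset.sum_eq_single_of_mem i hi fun j hj hji => hPP i hi j hj hji.symm]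
  exact (hP i hi).isIdempotentElem

/-- The `X i` have pairwise orthogonal ranges, and so do the `P i`. Pythagoras applies on both
sides, so the bound does not grow with the number of terms. -/
theorem norm_sum_mul_le_of_orthogonal {ι : Type*} (s : Finset ι) (X P : ι → (H →L[ℂ] H)) {ε : ℝ}
    (hε : 0 ≤ ε) (hX : ∀ i ∈ s, ‖X i‖ ≤ ε)
    (hXX : ∀ i ∈ s, ∀ j ∈ s, i ≠ j → star (X i) * X j = 0)
    (hP : ∀ i ∈ s, IsStarProjection (P i))
    (hPP : ∀ i ∈ s, ∀ j ∈ s, i ≠ j → P i * P j = 0) : ‖∑ i ∈ s, X i * P i‖ ≤ ε := by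
  refine ContinuousLinearMap.opNorm_le_bound _ hε fun v => ?_
  have h1 : ‖(∑ i ∈ s, X i * P i) v‖ ^ 2 = ∑ i ∈ s, ‖X i (P i v)‖ ^ 2 := by
    rw [sum_apply]
    refine norm_sq_sum_of_pairwise_orthogonal s (fun i => X i (P i v)) fun i hi j hj hij => ?_
    rw [← ContinuousLinearMap.adjoint_inner_right, ← ContinuousLinearMap.star_eq_adjoint,
      ← mul_apply_eq_comp, hXX i hi j hj hij, zero_apply, inner_zero_right]
  have h2 : ‖(∑ i ∈ s, P i) v‖ ^ 2 = ∑ i ∈ s, ‖P i v‖ ^ 2 := by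
    rw [sum_apply]
    refine norm_sq_sum_of_pairwise_orthogonal s (fun i => P i v) fun i hi j hj hij => ?_
    rw [← ContinuousLinearMap.adjoint_inner_right, ← ContinuousLinearMap.star_eq_adjoint,
      ← mul_apply_eq_comp, (hP i hi).isSelfAdjoint.star_eq, hPP i hi j hj hij, zero_apply,
      inner_zero_right]
  have h3 : ‖(∑ i ∈ s, P i) v‖ ≤ ‖v‖ := by
    simpa using (∑ i ∈ s, P i).le_of_opNorm_le (isStarProjection_sum s P hP hPP).norm_le v
  refine le_of_sq_le_sq ?_ (by positivity)
  calc ‖(∑ i ∈ s, X i * P i) v‖ ^ 2 = ∑ i ∈ s, ‖X i (P i v)‖ ^ 2 := h1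
    _ ≤ ∑ i ∈ s, ε ^ 2 * ‖P i v‖ ^ 2 := by
      refine Finset.sum_le_sum fun i hi => ?_
      rw [← mul_pow]
      exact pow_le_pow_left₀ (norm_nonneg _) ((X i).le_of_opNorm_le (hX i hi) _) 2
    _ = ε ^ 2 * ‖(∑ i ∈ s, P i) v‖ ^ 2 := by rw [h2, Finset.mul_sum]
    _ ≤ ε ^ 2 * ‖v‖ ^ 2 := by gcongr
    _ = (ε * ‖v‖) ^ 2 := by ring

theorem sum_smul_mul_sum_smul {B ι : Type*} [Ring B] [Algebra ℂ B] [Fintype ι] {P : ι → B}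
    (hP : ∀ i, IsIdempotentElem (P i)) (hPP : ∀ i j, i ≠ j → P i * P j = 0) (a b : ι → ℂ) :
    (∑ i, a i • P i) * ∑ i, b i • P i = ∑ i, (a i * b i) • P i := by
  rw [Finset.sum_mul_sum]
  refine Finset.sum_congr rfl fun i _ => ?_
  rw [Finset.sum_eq_single i (fun j _ hji => by rw [smul_mul_smul_comm, hPP i j hji.symm, smul_zero])
    (by simp), smul_mul_smul_comm, hP i]

/-- Off the range of `a`, the inverse of `z - ∑ a i • P i` is `∑ (z - a i)⁻¹ • P i`. -/
theorem spectrum_sum_smul_subset {B ι : Type*} [Ring B] [Algebra ℂ B] [Fintype ι] {P : ι → B}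
    (hP : ∀ i, IsIdempotentElem (P i)) (hPP : ∀ i j, i ≠ j → P i * P j = 0) (hs : ∑ i, P i = 1)
    (a : ι → ℂ) : spectrum ℂ (∑ i, a i • P i) ⊆ Set.range a := by
  intro z hz
  by_contra hza
  have hne (i : ι) : z - a i ≠ 0 := fun h => hza ⟨i, (sub_eq_zero.mp h).symm⟩
  have h1 : algebraMap ℂ B z - ∑ i, a i • P i = ∑ i, (z - a i) • P i := by
    simp only [sub_smul, Finset.sum_sub_distrib, ← Finset.smul_sum, hs,
      Algebra.algebraMap_eq_smul_one]
  refine hz ?_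
  rw [spectrum.mem_resolventSet_iff, h1]
  refine ⟨⟨∑ i, (z - a i) • P i, ∑ i, (z - a i)⁻¹ • P i, ?_, ?_⟩, rfl⟩
  · rw [sum_smul_mul_sum_smul hP hPP]
    simpa [mul_inv_cancel₀ (hne _)] using hs
  · rw [sum_smul_mul_sum_smul hP hPP]
    simpa [inv_mul_cancel₀ (hne _)] using hs

theorem isClosed_selfAdjoints {L : StarSubalgebra ℂ (H →L[ℂ] H)}
    (hL : IsClosed (L : Set (H →L[ℂ] H))) : IsClosed (selfAdjoints L) :=
  hL.inter (isClosed_eq continuous_star continuous_id)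

/-- A bounded continuous truncation of the identity; the radius `3 / 2 * ε` makes translates by at
least `3 * ε` have product zero. -/
theorem exists_continuous_cutoff_id {ε : ℝ} (hε : 0 < ε) :
    ∃ h : ℝ → ℝ, Continuous h ∧ (∀ x, |x| < ε → h x = x) ∧ (∀ x, 3 / 2 * ε ≤ |x| → h x = 0) ∧
      ∀ x, |h x| ≤ ε := by
  obtain ⟨φ, hφ, hφ0, hφ1, hφb⟩ := exists_continuous_ramp (show ε < 3 / 2 * ε by linarith)
  refine ⟨fun x => max (-ε) (min x ε) * (1 - φ |x|), by fun_prop, fun x hx => ?_, fun x hx => ?_,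
    fun x => ?_⟩
  · obtain ⟨h1, h2⟩ := abs_lt.mp hx
    simp [hφ0 _ hx.le, min_eq_left h2.le, max_eq_right h1.le]
  · simp [hφ1 _ hx]
  · have h1 : |max (-ε) (min x ε)| ≤ ε :=
      abs_le.mpr ⟨le_max_left _ _, max_le (by linarith) (min_le_right _ _)⟩
    have h2 : |1 - φ (|x|)| ≤ 1 := by
      rw [abs_of_nonneg (by linarith [hφb (|x|)])]
      linarith [hφb (|x|)]
    rw [abs_mul]
    calc _ ≤ ε * 1 := by gcongr
      _ = ε := mul_one ε

theorem exists_grid_cover {A : H →L[ℂ] H} {ε : ℝ} (hε : 0 < ε) :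
    ∃ (m : ℕ) (c : ℝ), spectrum ℂ A ⊆ ⋃ j : Fin m, {z : ℂ | |z.re - (c + j * ε)| < ε} := by
  obtain ⟨R, hR⟩ := (spectrum.isCompact (𝕜 := ℂ) A).isBounded.exists_norm_le
  refine ⟨⌊2 * R / ε⌋₊ + 1, -R, fun z hz => ?_⟩
  obtain ⟨h1, h2⟩ := abs_le.mp ((Complex.abs_re_le_norm z).trans (hR z hz))
  have h0 : 0 ≤ (z.re + R) / ε := div_nonneg (by linarith) hε.le
  have h3 : ⌊(z.re + R) / ε⌋₊ ≤ ⌊2 * R / ε⌋₊ :=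
    Nat.floor_mono (div_le_div_of_nonneg_right (by linarith) hε.le)
  refine Set.mem_iUnion.mpr ⟨⟨⌊(z.re + R) / ε⌋₊, Nat.lt_succ_of_le h3⟩, ?_⟩
  have h4 := Nat.floor_le h0
  have h5 := Nat.lt_floor_add_one ((z.re + R) / ε)
  rw [le_div_iff₀ hε] at h4
  rw [div_lt_iff₀ hε] at h5
  change |z.re - (-R + (⌊(z.re + R) / ε⌋₊ : ℝ) * ε)| < ε
  rw [abs_lt]
  constructor <;> linarith

/-- With `X j = h(A - λ j)`, where `λ j = c + j * ε`, the range condition gives `(A - λ j) P j = X j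
P j` and `‖X j‖ ≤ ε`. For indices in one residue class mod 3 the products `X i * X j` vanish, so
each of the three classes contributes at most `ε`. -/
theorem norm_sub_sum_smul_le {A : H →L[ℂ] H} (hA : IsSelfAdjoint A) {m : ℕ} {c ε : ℝ}
    (hε : 0 < ε) {P : Fin m → (H →L[ℂ] H)} (hP : ∀ j, IsStarProjection (P j))
    (hPP : ∀ i j, i ≠ j → P i * P j = 0) (hs : ∑ j, P j = 1)
    (hr : ∀ j : Fin m, Set.range (P j) ⊆
      Set.range (spectralProjection A {z : ℂ | |z.re - (c + j * ε)| < ε})) :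
    ‖A - ∑ j : Fin m, (c + j * ε) • P j‖ ≤ 3 * ε := by
  obtain ⟨h, hc, h1, h2, h3⟩ := exists_continuous_cutoff_id hε
  set X : Fin m → (H →L[ℂ] H) := fun j => cfc (fun x : ℝ => h (x - (c + j * ε))) A with hX
  have hterm (j : Fin m) : A * P j - (c + j * ε) • P j = X j * P j := by
    have hopen : IsOpen {z : ℂ | |z.re - (c + j * ε)| < ε} :=
      isOpen_lt (by fun_prop) continuous_const
    have h4 := cfc_mul_eq_zero_of_range_subset hA hopen (hr j)
      (f := fun x => (x - (c + j * ε)) - h (x - (c + j * ε))) (by fun_prop) fun x hx => by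
        have hx' : |x - (c + j * ε)| < ε := hx
        rw [h1 _ hx', sub_self]
    rw [cfc_sub (fun x => x - (c + j * ε)) (fun x => h (x - (c + j * ε))) A (by fun_prop)
        (hc.comp (continuous_sub_right _)).continuousOn,
      cfc_sub (fun x => x) (fun _ => c + j * ε) A (by fun_prop) (by fun_prop),
      cfc_id' ℝ A, cfc_const _ A, sub_mul, sub_mul, sub_eq_zero,
      ← Algebra.smul_def] at h4
    exact h4
  have hD : A - ∑ j : Fin m, (c + j * ε) • P j = ∑ j, X j * P j := by
    calc A - ∑ j : Fin m, (c + j * ε) • P j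
        = A * ∑ j, P j - ∑ j : Fin m, (c + j * ε) • P j := by rw [hs, mul_one]
      _ = ∑ j, X j * P j := by
        rw [Finset.mul_sum, ← Finset.sum_sub_distrib]
        exact Finset.sum_congr rfl fun j _ => hterm j
  let r : Fin m → Fin 3 := fun j => ⟨j % 3, Nat.mod_lt _ (by norm_num)⟩
  rw [hD, ← Finset.sum_fiberwise Finset.univ r]
  refine (norm_sum_le _ _).trans ?_
  calc _ ≤ ∑ _k : Fin 3, ε := Finset.sum_le_sum fun k _ => ?_
    _ = 3 * ε := by simp
  refine norm_sum_mul_le_of_orthogonal _ X P hε.le (fun j _ => ?_) (fun i hi j hj hij => ?_)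
    (fun j _ => hP j) fun i _ j _ hij => hPP i j hij
  · exact norm_cfc_le hε.le fun x _ => h3 _
  · have hij' : (i : ℕ) % 3 = j % 3 := by
      have hi' : r i = k := by simpa using hi
      have hj' : r j = k := by simpa using hj
      exact congrArg Fin.val (hi'.trans hj'.symm)
    have hne : (i : ℕ) ≠ j := fun h => hij (Fin.ext h)
    have hsep : (i : ℝ) + 3 ≤ j ∨ (j : ℝ) + 3 ≤ i := by
      have : (i : ℕ) + 3 ≤ j ∨ (j : ℕ) + 3 ≤ i := by omega
      exact_mod_cast this
    rw [(cfc_predicate _ A : IsSelfAdjoint (X i)).star_eq, hX]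
    simp only
    rw [← cfc_mul (fun x => h (x - (c + i * ε))) (fun x => h (x - (c + j * ε))) A
      (hc.comp (continuous_sub_right _)).continuousOn
      (hc.comp (continuous_sub_right _)).continuousOn, cfc_congr (g := fun _ => (0 : ℝ)) fun x _ => ?_, cfc_const_zero]
    by_contra hne0
    obtain ⟨h4, h5⟩ := mul_ne_zero_iff.mp hne0
    have h6 : |x - (c + i * ε)| < 3 / 2 * ε := not_le.mp fun h' => h4 (h2 _ h')
    have h7 : |x - (c + j * ε)| < 3 / 2 * ε := not_le.mp fun h' => h5 (h2 _ h')
    obtain ⟨h8, h9⟩ := abs_lt.mp h6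
    obtain ⟨h10, h11⟩ := abs_lt.mp h7
    -- Two centres at distance at least `3 * ε` cannot both be within less than `3 / 2 * ε` of `x`.
    rcases hsep with h' | h' <;> nlinarith

theorem selfAdjoints_eq_closure_finiteSpectrum {L : StarSubalgebra ℂ (H →L[ℂ] H)}
    (hL : IsClosed (L : Set (H →L[ℂ] H)))
    (h : ∀ A ∈ selfAdjoints L, ∀ (m : ℕ) (Ω : Fin m → Set ℂ), (∀ j, IsOpen (Ω j)) →
      spectrum ℂ A ⊆ ⋃ j, Ω j → HasApproxSpectralProjections L A Ω) :
    selfAdjoints L = closure (finiteSpectrum L ∩ selfAdjoints L) := by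
  refine Set.Subset.antisymm (fun A hA => ?_)
    (closure_minimal Set.inter_subset_right (isClosed_selfAdjoints hL))
  rw [Metric.mem_closure_iff]
  intro η hη
  have hε : 0 < η / 4 := by positivity
  obtain ⟨m, c, hcov⟩ := exists_grid_cover (A := A) hε
  obtain ⟨P, hPL, hP, hPP, hs, hr⟩ := h A hA m _
    (fun j => isOpen_lt (by fun_prop) continuous_const) hcov
  have hsum : ∑ j : Fin m, (c + j * (η / 4)) • P j =
      ∑ j : Fin m, ((c + j * (η / 4) : ℝ) : ℂ) • P j :=
    Finset.sum_congr rfl fun j _ => (Complex.coe_smul _ _).symm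
  have hmem : ∑ j : Fin m, (c + j * (η / 4)) • P j ∈ L := by
    rw [hsum]
    exact sum_mem fun j _ => L.smul_mem (hPL j) _
  refine ⟨∑ j : Fin m, (c + j * (η / 4)) • P j, ⟨⟨hmem, ?_⟩, hmem, ?_⟩, ?_⟩
  · rw [hsum]
    exact (Set.finite_range _).subset
      (spectrum_sum_smul_subset (fun j => (hP j).isIdempotentElem) hPP hs _)
  · exact isSelfAdjoint_sum _ fun j _ => (IsSelfAdjoint.all _).smul (hP j).isSelfAdjoint
  · rw [dist_eq_norm]
    linarith [norm_sub_sum_smul_le hA.2 hε hP hPP hs hr]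

theorem hasRealRankZero_of_closure_finiteSpectrum {L : StarSubalgebra ℂ (H →L[ℂ] H)}
    (hL : IsClosed (L : Set (H →L[ℂ] H)))
    (h : selfAdjoints L = closure (finiteSpectrum L ∩ selfAdjoints L)) : HasRealRankZero L := by
  refine Set.Subset.antisymm
    (closure_minimal Set.inter_subset_right (isClosed_selfAdjoints hL)) fun A hA => ?_
  rw [h] at hA
  refine closure_minimal ?_ isClosed_closure hA
  rintro F ⟨⟨hFL, hFf⟩, -, hFs⟩
  rw [Metric.mem_closure_iff]
  intro ε hε
  have hfin : {t : ℝ | (t : ℂ) ∈ spectrum ℂ F}.Finite :=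
    hFf.preimage Complex.ofReal_injective.injOn
  obtain ⟨t, ⟨ht0, htε⟩, ht⟩ := (Set.Ioo_infinite hε).exists_notMem_finite hfin
  have hu : IsUnit (F - algebraMap ℂ (H →L[ℂ] H) t) := by
    -- `t` lies outside the spectrum of `F`.
    rw [← neg_sub]
    exact (spectrum.notMem_iff.mp ht).neg
  have hmem : F - algebraMap ℂ (H →L[ℂ] H) t ∈ L := sub_mem hFL (algebraMap_mem L _)
  refine ⟨F - algebraMap ℂ (H →L[ℂ] H) t, ⟨⟨hmem, hu⟩, hmem, ?_⟩, ?_⟩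
  · exact hFs.sub (IsSelfAdjoint.algebraMap (H →L[ℂ] H) (Complex.conj_ofReal t))
  · rw [dist_eq_norm, sub_sub_cancel]
    rw [Algebra.algebraMap_eq_smul_one, norm_smul, Complex.norm_real, Real.norm_of_nonneg ht0.le]
    have h1 : ‖(1 : H →L[ℂ] H)‖ ≤ 1 := (IsStarProjection.one _).norm_le
    nlinarith

end SpectralTheory

/-! ### Chains of cuts and the construction of the approximate spectral projections. -/

namespace IsCut

variable {B : Type*} [CStarAlgebra B] {L : StarSubalgebra ℂ B} {A : B} {a b a' b' : ℝ} {E E' : B}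

theorem mul_eq_left (hA : IsSelfAdjoint A) (h : IsCut L A a b E) (h' : IsCut L A a' b' E')
    (hb : b < a') : E * E' = E := by
  obtain ⟨φ, hφ, hφ0, hφ1, -⟩ := exists_continuous_ramp hb
  -- The ramp lives in the gap `(b, a')`: `E` kills `φ(A)` and `1 - E'` kills `1 - φ(A)`, so
  -- splitting `1 = φ(A) + (1 - φ(A))` gives `E * (1 - E') = 0`.
  have h1 := h.mul_cfc φ hφ fun x _ hx => hφ0 x hx.le
  have h2 := h'.one_sub_mul_cfc (fun x => 1 - φ x) (by fun_prop) fun x _ hx => by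
    rw [hφ1 x hx.le, sub_self]
  have h3 := congrArg star h2
  rw [cfc_sub (fun _ => 1) φ A (by fun_prop) (by fun_prop), cfc_const_one ℝ A] at h3
  simp only [star_mul, star_sub, star_one, star_zero, h'.proj.isSelfAdjoint.star_eq,
    (cfc_predicate φ A : IsSelfAdjoint _).star_eq] at h3
  have h4 : E * (1 - E') = E * cfc φ A * (1 - E') + E * ((1 - cfc φ A) * (1 - E')) := by
    noncomm_ring
  rw [h1, h3, zero_mul, mul_zero, add_zero, mul_sub, mul_one, sub_eq_zero] at h4
  exact h4.symm

/-- The difference of two cuts lives over `[a, b']`. A ramp from `a` to `b'` splits `1 - f` into a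
part supported below `a`, killed by `1 - E` and `1 - E'`, and a part supported above `b'`, killed by
`E` and `E'`. -/
theorem sub_mul_cfc_eq (hA : IsSelfAdjoint A) (h : IsCut L A a b E) (h' : IsCut L A a' b' E')
    (ha : a ≤ a') (hb : b ≤ b') (hab : a < b') {f : ℝ → ℝ} (hf : Continuous f)
    (hf1 : ∀ x ∈ spectrum ℝ A, a ≤ x → x ≤ b' → f x = 1) : (E' - E) * cfc f A = E' - E := by
  obtain ⟨φ, hφ, hφ0, hφ1, -⟩ := exists_continuous_ramp hab
  have hz₁ : ∀ x ∈ spectrum ℝ A, a < x → (1 - f x) * (1 - φ x) = 0 := fun x hx hax => by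
    rcases le_total x b' with hxb | hxb
    · rw [hf1 x hx hax.le hxb, sub_self, zero_mul]
    · rw [hφ1 x hxb, sub_self, mul_zero]
  have hz₂ : ∀ x ∈ spectrum ℝ A, x < b' → (1 - f x) * φ x = 0 := fun x hx hxb => by
    rcases le_total a x with hax | hax
    · rw [hf1 x hx hax hxb.le, sub_self, zero_mul]
    · rw [hφ0 x hax, mul_zero]
  have h1 := h.one_sub_mul_cfc (fun x => (1 - f x) * (1 - φ x)) (by fun_prop) hz₁
  have h2 := h'.one_sub_mul_cfc (fun x => (1 - f x) * (1 - φ x)) (by fun_prop)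
    fun x hx hax => hz₁ x hx (ha.trans_lt hax)
  have h3 := h'.mul_cfc (fun x => (1 - f x) * φ x) (by fun_prop) hz₂
  have h4 := h.mul_cfc (fun x => (1 - f x) * φ x) (by fun_prop)
    fun x hx hxb => hz₂ x hx (hxb.trans_le hb)
  have h5 : 1 - cfc f A =
      cfc (fun x => (1 - f x) * (1 - φ x)) A + cfc (fun x => (1 - f x) * φ x) A := by
    rw [← cfc_add A (fun x => (1 - f x) * (1 - φ x)) (fun x => (1 - f x) * φ x) (by fun_prop)
      (by fun_prop), ← cfc_const_one ℝ A, ← cfc_sub (fun _ => 1) f A (by fun_prop) (by fun_prop)]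
    exact cfc_congr fun x _ => by ring
  have h6 : (E' - E) * (1 - cfc f A) = 0 := by
    rw [h5]
    calc (E' - E) * (cfc (fun x => (1 - f x) * (1 - φ x)) A + cfc (fun x => (1 - f x) * φ x) A)
        = (1 - E) * cfc (fun x => (1 - f x) * (1 - φ x)) A
          - (1 - E') * cfc (fun x => (1 - f x) * (1 - φ x)) A
          + E' * cfc (fun x => (1 - f x) * φ x) A - E * cfc (fun x => (1 - f x) * φ x) A := by
          noncomm_ring
      _ = 0 := by rw [h1, h2, h3, h4]; simp
  rw [mul_sub, mul_one, sub_eq_zero] at h6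
  exact h6.symm

end IsCut

namespace SpectralTheory

variable {H : Type*} [NormedAddCommGroup H] [InnerProductSpace ℂ H] [CompleteSpace H]

theorem spectralProjection_mul_sub_of_isCut {L : StarSubalgebra ℂ (H →L[ℂ] H)} {A : H →L[ℂ] H}
    (hA : IsSelfAdjoint A) {a b a' b' : ℝ} {E E' : H →L[ℂ] H} (h : IsCut L A a b E)
    (h' : IsCut L A a' b' E') (ha : a ≤ a') (hb : b ≤ b') (hab : a < b') {Ω : Set ℂ}
    (hΩ : IsOpen Ω) (hsub : ∀ z ∈ spectrum ℂ A, a ≤ z.re → z.re ≤ b' → z ∈ Ω) :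
    spectralProjection A Ω * (E' - E) = E' - E := by
  have hK : IsCompact (spectrum ℂ A ∩ {z | a ≤ z.re ∧ z.re ≤ b'}) :=
    (spectrum.isCompact A).inter_right
      ((isClosed_le continuous_const Complex.continuous_re).inter
        (isClosed_le Complex.continuous_re continuous_const))
  obtain ⟨g, hg1, hg0, hgc, hg01⟩ := exists_continuous_one_zero_of_isCompact hK
    hΩ.isClosed_compl (Set.disjoint_compl_right_iff_subset.mpr
      fun z hz => hsub z hz.1 hz.2.1 hz.2.2)
  let f : C_c(ℂ, ℝ) := ⟨g, hgc⟩
  have h1 := h.sub_mul_cfc_eq hA h' ha hb hab (f := fun x : ℝ => f (x : ℂ))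
    (f.continuous.comp Complex.continuous_ofReal) fun x hx hax hxb =>
      hg1 ⟨(spectrum.algebraMap_mem_iff ℂ).mpr hx, by simpa using ⟨hax, hxb⟩⟩
  have h2 := congrArg star h1
  rw [← realCfc_eq_cfc hA, star_mul, (realCfc_isSelfAdjoint A f).star_eq,
    (h'.proj.isSelfAdjoint.sub h.proj.isSelfAdjoint).star_eq] at h2
  ext x
  rw [mul_apply_eq_comp]
  refine spectralProjection_apply_of_realCfc_apply hΩ (f := f) (fun z => (hg01 z).2)
    (fun z hz => hg0 hz) ?_
  rw [← mul_apply_eq_comp, h2]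

theorem hasApproxSpectralProjections_of_hasRealRankZero {L : StarSubalgebra ℂ (H →L[ℂ] H)}
    (hL : IsClosed (L : Set (H →L[ℂ] H))) (h : HasRealRankZero L) {A : H →L[ℂ] H}
    (hA : A ∈ selfAdjoints L) {m : ℕ} {Ω : Fin m → Set ℂ} (hΩ : ∀ j, IsOpen (Ω j))
    (hcov : spectrum ℂ A ⊆ ⋃ j, Ω j) : HasApproxSpectralProjections L A Ω := by
  -- On the zero space the spectrum is empty and the family may be empty; otherwise a spectral point
  -- supplies a default index `j₀`.
  rcases subsingleton_or_nontrivial H with hH | hH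
  · exact ⟨fun _ => 0, fun _ => zero_mem L, fun _ => .zero _, fun _ _ _ => mul_zero 0,
      Subsingleton.elim _ _, fun j => by rintro _ ⟨x, rfl⟩; exact ⟨x, Subsingleton.elim _ _⟩⟩
  have hr : ∀ S ∈ L, IsSelfAdjoint S →
      S ∈ closure {T : H →L[ℂ] H | T ∈ L ∧ IsSelfAdjoint T ∧ IsUnit T} := by
    intro S hSL hS
    have hS' : S ∈ closure (invertibles L ∩ selfAdjoints L) := by
      rw [show closure (invertibles L ∩ selfAdjoints L) = selfAdjoints L from h]
      exact ⟨hSL, hS⟩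
    refine closure_mono ?_ hS'
    exact fun T hT => ⟨hT.1.1, hT.2.2, hT.1.2⟩
  obtain ⟨ε, hε, hleb⟩ := lebesgue_number_lemma_of_metric (spectrum.isCompact A) hΩ hcov
  obtain ⟨z₀, hz₀⟩ := spectrum.nonempty A
  obtain ⟨j₀, -⟩ := hleb z₀ hz₀
  obtain ⟨R, hR⟩ := (spectrum.isCompact (𝕜 := ℝ) A).isBounded.exists_norm_le
  set δ := ε / 4 with hδ
  have hδ0 : 0 < δ := by positivity
  obtain ⟨n, hn⟩ := exists_nat_gt ((2 * R + δ) / (2 * δ))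
  rw [div_lt_iff₀ (by positivity)] at hn
  -- Cuts are made on `(a k, a k + δ)`, with gaps of length `δ` between them. The first lies below
  -- the spectrum and the last, at `a n > R`, above it; there the vanishing conditions on the
  -- spectrum are vacuous for the constant `1`, whence `E 0 = 0` and `E n = 1`.
  set a : ℕ → ℝ := fun k => -R - δ + 2 * k * δ with ha
  have hasucc (k : ℕ) : a (k + 1) = a k + 2 * δ := by simp only [ha]; push_cast; ring
  have hamono : Monotone a := monotone_nat_of_le_succ fun k => by rw [hasucc]; linarith
  choose E hE using fun k : ℕ => exists_cut hL hr hA.1 hA.2 (show a k < a k + δ by linarith)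
  have hE0 : E 0 = 0 := by
    have h1 := (hE 0).mul_cfc (fun _ => 1) continuous_const fun x hx hx' => by
      have h2 := (abs_le.mp (hR x hx)).1
      simp only [ha] at hx'
      push_cast at hx'
      linarith
    rwa [cfc_const_one ℝ A hA.2, mul_one] at h1
  have hEn : E n = 1 := by
    have h1 := (hE n).one_sub_mul_cfc (fun _ => 1) continuous_const fun x hx hx' => by
      have h2 := (abs_le.mp (hR x hx)).2
      simp only [ha] at hx'
      linarith
    rw [cfc_const_one ℝ A hA.2, mul_one, sub_eq_zero] at h1
    exact h1.symm
  have hEE {k l : ℕ} (hkl : k ≤ l) : E k * E l = E k := by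
    rcases hkl.eq_or_lt with rfl | hkl
    · exact (hE k).proj.isIdempotentElem
    · refine (hE k).mul_eq_left hA.2 (hE l) ?_
      have := hamono (Nat.succ_le_of_lt hkl)
      rw [Nat.succ_eq_add_one, hasucc] at this
      linarith
  set D : ℕ → (H →L[ℂ] H) := fun k => E (k + 1) - E k with hD
  have hDP (k : ℕ) : IsStarProjection (D k) :=
    (hE k).proj.sub_of_mul_eq_left (hE (k + 1)).proj (hEE k.le_succ)
  have hDlt {k l : ℕ} (hkl : k < l) : D k * D l = 0 := by
    simp only [hD]
    rw [mul_sub, sub_mul, sub_mul, hEE (show k + 1 ≤ l + 1 by omega), hEE (show k ≤ l + 1 by omega),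
      hEE (show k + 1 ≤ l by omega), hEE hkl.le, sub_self]
  have hDD (k l : ℕ) (hkl : k ≠ l) : D k * D l = 0 := by
    rcases hkl.lt_or_gt with h' | h'
    · exact hDlt h'
    · have := congrArg star (hDlt h')
      rwa [star_mul, star_zero, (hDP k).isSelfAdjoint.star_eq,
        (hDP l).isSelfAdjoint.star_eq] at this
  have hJ (k : ℕ) : ∃ j, spectralProjection A (Ω j) * D k = D k := by
    -- The interval has length `3 * δ`, less than the Lebesgue number `ε = 4 * δ`; if it misses the
    -- spectrum, any index serves.
    have hj : ∃ j, ∀ z ∈ spectrum ℂ A, a k ≤ z.re → z.re ≤ a (k + 1) + δ → z ∈ Ω j := by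
      by_cases hne : ∃ w ∈ spectrum ℂ A, a k ≤ w.re ∧ w.re ≤ a (k + 1) + δ
      · obtain ⟨w, hw, hw1, hw2⟩ := hne
        obtain ⟨j, hj⟩ := hleb w hw
        refine ⟨j, fun z hz hz1 hz2 => hj ?_⟩
        rw [hasucc] at hw2 hz2
        rw [Metric.mem_ball, dist_eq_norm, hA.2.mem_spectrum_eq_re hz, hA.2.mem_spectrum_eq_re hw,
          ← Complex.ofReal_sub, Complex.norm_real, Real.norm_eq_abs, abs_lt]
        constructor <;> linarith
      · exact ⟨j₀, fun z hz hz1 hz2 => (hne ⟨z, hz, hz1, hz2⟩).elim⟩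
    obtain ⟨j, hj⟩ := hj
    exact ⟨j, spectralProjection_mul_sub_of_isCut hA.2 (hE k) (hE (k + 1)) (hamono k.le_succ)
      (by rw [hasucc]; linarith) (by rw [hasucc]; linarith) (hΩ j) hj⟩
  choose J hJ using hJ
  refine ⟨fun j => ∑ k ∈ Finset.range n with J k = j, D k,
    fun j => sum_mem fun k _ => sub_mem (hE (k + 1)).mem (hE k).mem,
    fun j => isStarProjection_sum _ _ (fun k _ => hDP k) fun k _ l _ => hDD k l,
    fun i j hij => ?_, ?_, fun j => ?_⟩
  · simp only [Finset.sum_mul_sum]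
    refine Finset.sum_eq_zero fun k hk => Finset.sum_eq_zero fun l hl => hDD k l ?_
    rintro rfl
    exact hij ((Finset.mem_filter.mp hk).2.symm.trans (Finset.mem_filter.mp hl).2)
  · rw [Finset.sum_fiberwise, Finset.sum_range_sub, hEn, hE0, sub_zero]
  · rintro _ ⟨x, rfl⟩
    refine ⟨(∑ k ∈ Finset.range n with J k = j, D k) x, ?_⟩
    rw [← mul_apply_eq_comp, Finset.mul_sum]
    congr 1
    refine Finset.sum_congr rfl fun k hk => ?_
    rw [← (Finset.mem_filter.mp hk).2, hJ]

end SpectralTheory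

theorem corollary2p2 {H : Type*} [NormedAddCommGroup H] [InnerProductSpace ℂ H] [CompleteSpace H]
    (L : StarSubalgebra ℂ (H →L[ℂ] H)) (hL : IsClosed (L : Set (H →L[ℂ] H))) :
    List.TFAE
      [SpectralTheory.HasRealRankZero L,
        ∀ A ∈ SpectralTheory.selfAdjoints L, ∀ (m : ℕ) (Ω : Fin m → Set ℂ),
          (∀ j, IsOpen (Ω j)) → spectrum ℂ A ⊆ ⋃ j, Ω j →
            SpectralTheory.HasApproxSpectralProjections L A Ω,
        SpectralTheory.selfAdjoints L =
          closure (SpectralTheory.finiteSpectrum L ∩ SpectralTheory.selfAdjoints L)] := by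
  tfae_have 1 → 2 := fun h A hA m Ω hΩ hcov =>
    SpectralTheory.hasApproxSpectralProjections_of_hasRealRankZero hL h hA hΩ hcov
  tfae_have 2 → 3 := SpectralTheory.selfAdjoints_eq_closure_finiteSpectrum hL
  tfae_have 3 → 1 := SpectralTheory.hasRealRankZero_of_closure_finiteSpectrum hL
  tfae_finish
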